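/- Notation. For a complex Hilbert space $K$ let $\mathcal L(K)$ be the algebra of bounded operators, $\mathcal K(K)$ the ideal of compact operators, $\mathcal Q(K)=\mathcal L(K)/\mathcal K(K)$ the Calkin algebra and $\pi:\mathcal L(K)\to\mathcal Q(K)$ the quotient map. For a compact space $X\neq\emptyset$, the elements of the odd K-homology group $K_1(X)=\mathrm{Ext}(X)$ of Brown, Douglas and Fillmore are the equivalence classes of unital injective $*$-homomorphisms $\tau:C(X)\to\mathcal Q(K)$ with $K$ a separable infinite-dimensional Hilbert space, where $\tau_1:C(X)\to\mathcal Q(K_1)$ and $\tau_2:C(X)\to\mathcal Q(K_2)$ are equivalent if there is a unitary $U:K_1\to K_2$ such that $\tau_2(\varphi)=\pi(UTU^{-1})$ whenever $\tau_1(\varphi)=\pi(T)$. Put $K_1(\emptyset)=0$. Let $M$ be a compact metric space, $H$ a complex Hilbert space and $\sigma:C(M)\to\mathcal Q(H)$ a unital $*$-homomorphism (for example $\sigma=\pi\circ\sigma_0$ with $\sigma_0:C(M)\to\mathcal L(H)$ a unital $*$-homomorphism). An orthogonal projection $P$ on $H$ is called essentially normal relative to $\sigma$ if $\sigma(\varphi)\pi(P)=\pi(P)\sigma(\varphi)$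 for all $\varphi\in C(M)$. For such $P$, with $\mathcal P=\operatorname{ran}P$, let $\sigma_P:C(M)\to\mathcal Q(\mathcal P)$ be the unital $*$-homomorphism that sends $\varphi$ to the class of the compression $PT|_{\mathcal P}$, where $\pi(T)=\sigma(\varphi)$. Let $M_P\subseteq M$ be the common zero set of $\ker\sigma_P$; it is the closed set for which $\ker\sigma_P=\{\varphi:\varphi|_{M_P}=0\}$. Let $\hat\sigma_P:C(M_P)\to\mathcal Q(\mathcal P)$ be the injective unital $*$-homomorphism with $\hat\sigma_P(\varphi|_{M_P})=\sigma_P(\varphi)$. If $\mathcal P$ is separable, $\hat\sigma_P$ defines a class $[\hat\sigma_P]\in K_1(M_P)$ (the zero class if $M_P=\emptyset$, that is, if $\mathcal P$ is finite-dimensional). **Theorem.** Let $P$ and $Q$ be orthogonal projections on $H$, with ranges $\mathcal P$ and $\mathcal Q$, that are essentially normal relative to $\sigma$. Suppose that $\mathcal P\cap\mathcal Q^\perp=\mathcal P^\perp\cap\mathcal Q=\{0\}$ and that $\mathcal P+\mathcal Q^\perp$ is closed. Then $M_P=M_Q$, and, if $\mathcal P$ and $\mathcal Q$ are separable (in particular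 if $H$ is), so that the classes are defined, $[\hat\sigma_P]=[\hat\sigma_Q]$ in $K_1(M_P)$. -/

import Mathlib

open scoped InnerProductSpace

universe u v

set_option linter.unusedSectionVars false

noncomputable section

namespace EssNormal

section Compactness

variable {E F : Type*} [NormedAddCommGroup E] [InnerProductSpace ℂ E] [CompleteSpace E]
  [NormedAddCommGroup F] [InnerProductSpace ℂ F] [CompleteSpace F]

/-- A compactness criterion for bounded operators between Hilbert spaces. -/
theorem isCompactOperator_of_sq_le (T : E →L[ℂ] F)
    (h : ∀ ε : ℝ, 0 < ε → ∃ C : E →L[ℂ] E, IsCompactOperator C ∧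
      ∀ x, ‖T x‖ ^ 2 ≤ ε * ‖x‖ ^ 2 + ‖C x‖ * ‖x‖) :
    IsCompactOperator T := by
  refine (isCompactOperator_iff_isCompact_closure_image_ball (𝕜₁ := ℂ) (T : E →ₗ[ℂ] F)
    (zero_lt_one)).2 ?_
  refine TotallyBounded.isCompact_of_isClosed ?_ isClosed_closure
  refine TotallyBounded.closure ?_
  rw [Metric.totallyBounded_iff]
  intro ε hε
  obtain ⟨C, hC, hle⟩ := h (ε ^ 2 / 8) (by positivity)
  have hCb : TotallyBounded (C '' Metric.ball 0 1) :=
    ((isCompactOperator_iff_isCompact_closure_image_ball (𝕜₁ := ℂ) (C : E →ₗ[ℂ] E)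
      (zero_lt_one)).1 hC).totallyBounded.subset subset_closure
  obtain ⟨t, hts, htf, htc⟩ := Metric.finite_approx_of_totallyBounded hCb (ε ^ 2 / 8) (by positivity)
  obtain ⟨s, hsb, hsf, rfl⟩ := (Set.exists_subset_image_finite_and
    (p := fun r => r = t) (f := C) (s := Metric.ball 0 1)).1 ⟨t, hts, htf, rfl⟩
  refine ⟨T '' s, hsf.image _, ?_⟩
  rintro _ ⟨x, hx, rfl⟩
  obtain ⟨_, hy, hxy⟩ := Set.mem_iUnion₂.1 (htc ⟨x, hx, rfl⟩)
  obtain ⟨y, hys, rfl⟩ := hy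
  refine Set.mem_iUnion₂.2 ⟨T y, ⟨y, hys, rfl⟩, ?_⟩
  have hx1 : ‖x‖ < 1 := by simpa using hx
  have hy1 : ‖y‖ < 1 := by simpa using hsb hys
  have hxy2 : ‖x - y‖ ≤ 2 := (norm_sub_le _ _).trans (by linarith)
  have hCxy : ‖C (x - y)‖ < ε ^ 2 / 8 := by
    simpa [dist_eq_norm, map_sub] using hxy
  have hT := hle (x - y)
  have hlt : ‖T (x - y)‖ ^ 2 < ε ^ 2 := by
    have h0 := norm_nonneg (x - y)
    have h1 := norm_nonneg (C (x - y))
    have h2 : ‖x - y‖ ^ 2 ≤ 4 := by nlinarith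
    have h3 : ‖C (x - y)‖ * ‖x - y‖ ≤ ‖C (x - y)‖ * 2 := by gcongr
    have h4 : ε ^ 2 / 8 * ‖x - y‖ ^ 2 ≤ ε ^ 2 / 8 * 4 := by gcongr
    nlinarith
  have := lt_of_pow_lt_pow_left₀ 2 hε.le hlt
  simpa [dist_eq_norm, map_sub] using this

theorem isCompactOperator_adjoint {T : E →L[ℂ] F} (hT : IsCompactOperator T) :
    IsCompactOperator (ContinuousLinearMap.adjoint T) := by
  refine isCompactOperator_of_sq_le _ fun ε hε =>
    ⟨T ∘L ContinuousLinearMap.adjoint T, hT.comp_clm _, fun x => ?_⟩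
  have h1 : ‖ContinuousLinearMap.adjoint T x‖ ^ 2
      ≤ ‖(T ∘L ContinuousLinearMap.adjoint T) x‖ * ‖x‖ := by
    rw [← inner_self_eq_norm_sq (𝕜 := ℂ), ContinuousLinearMap.adjoint_inner_right]
    exact re_inner_le_norm _ _
  have : 0 ≤ ε * ‖x‖ ^ 2 := by positivity
  linarith

end Compactness

section Calkin

variable (K : Type*) [NormedAddCommGroup K] [InnerProductSpace ℂ K] [CompleteSpace K]

/-- The ideal of compact operators in the algebra of bounded operators on `K`. -/
def compactIdeal : Ideal (K →L[ℂ] K) where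
  carrier := {T | IsCompactOperator T}
  add_mem' ha hb := IsCompactOperator.add ha hb
  zero_mem' := isCompactOperator_zero
  smul_mem' c _ hx := IsCompactOperator.clm_comp hx c

instance compactIdeal_isTwoSided : (compactIdeal K).IsTwoSided :=
  ⟨fun {_} b ha => IsCompactOperator.comp_clm ha b⟩

/-- The Calkin algebra: bounded operators modulo compact operators. -/
abbrev Calkin : Type _ := (K →L[ℂ] K) ⧸ compactIdeal K

variable {K}

/-- The quotient map from bounded operators onto the Calkin algebra. -/
def toCalkin : (K →L[ℂ] K) →ₐ[ℂ] Calkin K := Ideal.Quotient.mkₐ ℂ (compactIdeal K)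

theorem toCalkin_surjective : Function.Surjective (toCalkin : (K →L[ℂ] K) → Calkin K) :=
  Ideal.Quotient.mkₐ_surjective ℂ _

theorem toCalkin_eq_iff {S T : K →L[ℂ] K} :
    toCalkin S = toCalkin T ↔ IsCompactOperator (S - T) :=
  Ideal.Quotient.eq

theorem toCalkin_eq_zero_iff {S : K →L[ℂ] K} :
    toCalkin S = 0 ↔ IsCompactOperator S :=
  Ideal.Quotient.eq_zero_iff_mem

/-- The involution of the Calkin algebra, induced by the adjoint of operators. -/
instance calkinStar : Star (Calkin K) where
  star := Quotient.map (fun T : K →L[ℂ] K => star T) fun S T h => by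
    have h1 : IsCompactOperator (S - T) := (Submodule.quotientRel_def _).1 h
    have h2 : IsCompactOperator (star S - star T) := by
      rw [← star_sub]; exact isCompactOperator_adjoint h1
    exact (Submodule.quotientRel_def _).2 h2

theorem star_toCalkin (T : K →L[ℂ] K) : star (toCalkin T) = toCalkin (star T) := rfl

instance calkinStarRing : StarRing (Calkin K) where
  star_involutive a := by
    obtain ⟨T, rfl⟩ := toCalkin_surjective a
    simp [star_toCalkin]
  star_mul a b := by
    obtain ⟨S, rfl⟩ := toCalkin_surjective a
    obtain ⟨T, rfl⟩ := toCalkin_surjective b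
    simp only [star_toCalkin, ← map_mul, star_mul]
  star_add a b := by
    obtain ⟨S, rfl⟩ := toCalkin_surjective a
    obtain ⟨T, rfl⟩ := toCalkin_surjective b
    simp only [star_toCalkin, ← map_add, star_add]

end Calkin

section Compression

variable {H : Type u} [NormedAddCommGroup H] [InnerProductSpace ℂ H] [CompleteSpace H]
  (P : Submodule ℂ H) [CompleteSpace P]

/-- The compression of `T` to the closed subspace `P`, i.e. `P T P` seen as an operator on `P`. -/
def compressOp (T : H →L[ℂ] H) : P →L[ℂ] P := P.orthogonalProjectionOnto ∘L T ∘L P.subtypeL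

/-- The compression of Calkin algebras induced by `compressOp`. -/
def compress : Calkin H → Calkin P :=
  Quotient.map (compressOp P) fun S T h => by
    have h1 : IsCompactOperator (S - T) := (Submodule.quotientRel_def _).1 h
    have h2 : IsCompactOperator (compressOp P S - compressOp P T) := by
      have : compressOp P S - compressOp P T
          = P.orthogonalProjectionOnto ∘L (S - T) ∘L P.subtypeL := by
        ext x; simp [compressOp]
      rw [this]
      exact (h1.comp_clm P.subtypeL).clm_comp P.orthogonalProjectionOnto
    exact (Submodule.quotientRel_def _).2 h2

theorem compress_toCalkin (T : H →L[ℂ] H) :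
    compress P (toCalkin T) = toCalkin (compressOp P T) := rfl

variable {M : Type v} [TopologicalSpace M]

/-- The orthogonal projection onto `P` is essentially normal relative to `σ`: its image in the
Calkin algebra commutes with the range of `σ`. -/
def IsEssentiallyNormal (σ : C(M, ℂ) →⋆ₐ[ℂ] Calkin H) : Prop :=
  ∀ φ : C(M, ℂ), Commute (σ φ) (toCalkin P.starProjection)

variable {P}

theorem compress_mul {a b : Calkin H} (hb : Commute b (toCalkin P.starProjection)) :
    compress P (a * b) = compress P a * compress P b := by
  obtain ⟨A, rfl⟩ := toCalkin_surjective a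
  obtain ⟨B, rfl⟩ := toCalkin_surjective b
  have hB : IsCompactOperator (B * P.starProjection - P.starProjection * B) := by
    rw [← toCalkin_eq_iff, map_mul, map_mul]; exact hb.eq
  rw [← map_mul, compress_toCalkin, compress_toCalkin, compress_toCalkin, ← map_mul,
    toCalkin_eq_iff]
  have : compressOp P (A * B) - compressOp P A * compressOp P B
      = (P.orthogonalProjectionOnto ∘L A ∘L (1 - P.starProjection)) ∘L
        (B * P.starProjection - P.starProjection * B) ∘L P.subtypeL := by
    ext x
    have hx : P.starProjection (x : H) = x := Submodule.starProjection_eq_self_iff.2 x.2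
    have h2 : P.starProjection (P.starProjection (B (x : H))) = P.starProjection (B (x : H)) :=
      Submodule.starProjection_eq_self_iff.2 (Submodule.starProjection_apply_mem _ _)
    simp [compressOp, hx, h2]
  rw [this]
  exact (hB.comp_clm P.subtypeL).clm_comp
    (P.orthogonalProjectionOnto ∘L A ∘L (1 - P.starProjection))

theorem compressOp_one : compressOp P (1 : H →L[ℂ] H) = 1 := by
  ext x; simp [compressOp]

theorem compressOp_star (T : H →L[ℂ] H) : compressOp P (star T) = star (compressOp P T) := by
  rw [ContinuousLinearMap.star_eq_adjoint, ContinuousLinearMap.star_eq_adjoint,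
    ContinuousLinearMap.eq_adjoint_iff]
  intro x y
  simp [compressOp, ContinuousLinearMap.adjoint_inner_left]

/-- The `*`-homomorphism `σ_P : φ ↦ P σ(φ) P` from `C(M)` to the Calkin algebra of `ran P`. -/
def compressedHom {σ : C(M, ℂ) →⋆ₐ[ℂ] Calkin H} (hP : IsEssentiallyNormal P σ) :
    C(M, ℂ) →⋆ₐ[ℂ] Calkin P where
  toFun φ := compress P (σ φ)
  map_one' := by
    rw [map_one, ← map_one toCalkin, compress_toCalkin, compressOp_one, map_one]
  map_mul' φ ψ := by rw [map_mul, compress_mul (hP ψ)]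
  map_zero' := by
    rw [map_zero, ← map_zero toCalkin, compress_toCalkin]
    rw [show compressOp P (0 : H →L[ℂ] H) = 0 by ext x; simp [compressOp], map_zero]
  map_add' φ ψ := by
    rw [map_add]
    obtain ⟨A, hA⟩ := toCalkin_surjective (σ φ)
    obtain ⟨B, hB⟩ := toCalkin_surjective (σ ψ)
    rw [← hA, ← hB, ← map_add, compress_toCalkin, compress_toCalkin, compress_toCalkin,
      ← map_add]
    congr 1; ext x; simp [compressOp]
  commutes' c := by
    rw [AlgHomClass.commutes σ, Algebra.algebraMap_eq_smul_one, ← map_one toCalkin, ← map_smul,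
      compress_toCalkin, Algebra.algebraMap_eq_smul_one, ← map_one toCalkin, ← map_smul]
    congr 1; ext x; simp [compressOp]
  map_star' φ := by
    rw [map_star]
    obtain ⟨A, hA⟩ := toCalkin_surjective (σ φ)
    rw [← hA, star_toCalkin, compress_toCalkin, compress_toCalkin, compressOp_star, star_toCalkin]

end Compression

section Support

variable {K : Type u} [NormedAddCommGroup K] [InnerProductSpace ℂ K] [CompleteSpace K]
  {M : Type v} [TopologicalSpace M]

/-- The common zero set in `M` of the kernel of `τ`. -/
def supportSet (τ : C(M, ℂ) →⋆ₐ[ℂ] Calkin K) : Set M := {x | ∀ φ, τ φ = 0 → φ x = 0}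

theorem isClosed_supportSet (τ : C(M, ℂ) →⋆ₐ[ℂ] Calkin K) : IsClosed (supportSet τ) := by
  simp only [supportSet, Set.ofPred_forall]
  exact isClosed_iInter fun φ => isClosed_iInter fun _ => isClosed_eq φ.continuous continuous_const

variable [CompactSpace M] [T2Space M]

instance compactSpace_supportSet (τ : C(M, ℂ) →⋆ₐ[ℂ] Calkin K) : CompactSpace (supportSet τ) :=
  isCompact_iff_compactSpace.1 (isClosed_supportSet τ).isCompact

/-- The kernel of `τ` consists of the functions that vanish on `supportSet τ`. -/
theorem map_eq_zero_iff_eqOn (τ : C(M, ℂ) →⋆ₐ[ℂ] Calkin K) (φ : C(M, ℂ)) :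
    τ φ = 0 ↔ ∀ x ∈ supportSet τ, φ x = 0 := by
  refine ⟨fun h x hx => hx φ h, fun h => ?_⟩
  have hcl : φ ∈ (RingHom.ker τ).closure := by
    rw [← ContinuousMap.idealOfSet_ofIdeal_eq_closure, ContinuousMap.mem_idealOfSet]
    intro x hx
    refine h x fun ψ hψ => ?_
    exact ContinuousMap.notMem_setOfIdeal.1 hx hψ
  obtain ⟨T, hT⟩ := toCalkin_surjective (τ φ)
  rw [← hT, toCalkin_eq_zero_iff]
  refine isCompactOperator_of_sq_le T fun ε hε => ?_
  have hs : 0 < √ε := Real.sqrt_pos.2 hε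
  obtain ⟨ψ, hψ, hd⟩ := Metric.mem_closure_iff.1
    (show φ ∈ closure ((RingHom.ker τ : Ideal C(M, ℂ)) : Set C(M, ℂ)) from hcl) _ hs
  have hψ0 : τ ψ = 0 := hψ
  set f : C(M, ℂ) := φ - ψ with hf
  have hfn : ∀ x, ‖f x‖ ^ 2 ≤ ε := fun x => by
    have h1 : ‖f x‖ ≤ √ε := (f.norm_coe_le_norm x).trans (by rw [hf, ← dist_eq_norm]; exact hd.le)
    calc ‖f x‖ ^ 2 ≤ √ε ^ 2 := by gcongr
      _ = ε := Real.sq_sqrt hε.le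
  let g : C(M, ℂ) := ⟨fun x => ((√(ε - ‖f x‖ ^ 2) : ℝ) : ℂ), by fun_prop⟩
  have hfg : star f * f + star g * g = (ε : ℂ) • (1 : C(M, ℂ)) := by
    ext x
    have h1 : star (f x) * f x = ((‖f x‖ ^ 2 : ℝ) : ℂ) := by
      rw [RCLike.star_def, RCLike.conj_mul]; simp
    have h2 : star (g x) * g x = ((ε - ‖f x‖ ^ 2 : ℝ) : ℂ) := by
      change star ((√(ε - ‖f x‖ ^ 2) : ℝ) : ℂ) * ((√(ε - ‖f x‖ ^ 2) : ℝ) : ℂ) = _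
      rw [RCLike.star_def, Complex.conj_ofReal, ← Complex.ofReal_mul,
        Real.mul_self_sqrt (sub_nonneg.2 (hfn x))]
    simp only [ContinuousMap.add_apply, ContinuousMap.mul_apply, ContinuousMap.star_apply, h1, h2]
    simp
  obtain ⟨B, hB⟩ := toCalkin_surjective (τ g)
  have hf' : τ f = toCalkin T := by rw [hf, map_sub, hψ0, sub_zero, hT]
  have hrel : toCalkin (star T * T + star B * B) = toCalkin ((ε : ℂ) • (1 : K →L[ℂ] K)) := by
    have := congrArg τ hfg
    rw [map_add, map_mul, map_mul, map_star, map_star, hf', ← hB, map_smul, map_one] at this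
    rw [map_add, map_mul, map_mul, map_smul, map_one, ← star_toCalkin, ← star_toCalkin, this]
  refine ⟨_, toCalkin_eq_iff.1 hrel, fun x => ?_⟩
  set C := star T * T + star B * B - (ε : ℂ) • (1 : K →L[ℂ] K) with hC
  have h1 : RCLike.re ⟪C x, x⟫_ℂ = ‖T x‖ ^ 2 + ‖B x‖ ^ 2 - ε * ‖x‖ ^ 2 := by
    simp only [hC, sub_apply, add_apply,
      mul_apply_eq_comp, inner_sub_left, inner_add_left,
      ContinuousLinearMap.star_eq_adjoint, ContinuousLinearMap.adjoint_inner_left, map_sub,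
      map_add, inner_self_eq_norm_sq, smul_apply, inner_smul_left,
      one_apply_eq_self]
    congr 1
    rw [Complex.conj_ofReal, RCLike.re_to_complex, Complex.re_ofReal_mul, ← RCLike.re_to_complex,
      inner_self_eq_norm_sq]
  have h2 : RCLike.re ⟪C x, x⟫_ℂ ≤ ‖C x‖ * ‖x‖ := re_inner_le_norm _ _
  nlinarith [sq_nonneg ‖B x‖]

/-- Restriction of functions to `X`, as a `*`-homomorphism `C(M) → C(X)`. -/
def restrictHom (X : Set M) : C(M, ℂ) →⋆ₐ[ℂ] C(X, ℂ) :=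
  ContinuousMap.compStarAlgHom' ℂ ℂ ⟨Subtype.val, continuous_subtype_val⟩

/-- `τ` factors uniquely through restriction to `supportSet τ`, by an injective homomorphism. -/
theorem exists_factor (τ : C(M, ℂ) →⋆ₐ[ℂ] Calkin K) :
    ∃ τ' : C(supportSet τ, ℂ) →⋆ₐ[ℂ] Calkin K,
      τ'.comp (restrictHom (supportSet τ)) = τ ∧ Function.Injective τ' := by
  have hsurj : ∀ f : C(supportSet τ, ℂ), ∃ φ, restrictHom (supportSet τ) φ = f := fun f => by
    obtain ⟨g, hg⟩ := ContinuousMap.exists_restrict_eq (isClosed_supportSet τ) f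
    exact ⟨g, hg⟩
  have hker : ∀ φ, restrictHom (supportSet τ) φ = 0 ↔ τ φ = 0 := fun φ => by
    rw [map_eq_zero_iff_eqOn]
    refine ⟨fun h x hx => DFunLike.congr_fun h (⟨x, hx⟩ : supportSet τ), fun h => ?_⟩
    ext x
    exact h x x.2
  have heq : ∀ φ ψ, restrictHom (supportSet τ) φ = restrictHom (supportSet τ) ψ ↔ τ φ = τ ψ :=
    fun φ ψ => by rw [← sub_eq_zero, ← map_sub, hker, map_sub, sub_eq_zero]
  choose e he using hsurj
  have key : ∀ φ, τ (e (restrictHom (supportSet τ) φ)) = τ φ := fun φ => (heq _ _).1 (he _)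
  refine ⟨{ toFun := fun f => τ (e f)
            map_one' := ?_, map_mul' := ?_, map_zero' := ?_, map_add' := ?_
            commutes' := ?_, map_star' := ?_ }, ?_, ?_⟩
  · rw [← map_one (restrictHom (supportSet τ)), key, map_one]
  · intro f g
    rw [← map_mul, ← heq, map_mul, he, he, he]
  · rw [← map_zero (restrictHom (supportSet τ)), key, map_zero]
  · intro f g
    rw [← map_add, ← heq, map_add, he, he, he]
  · intro c
    rw [← AlgHomClass.commutes (restrictHom (supportSet τ)), key, AlgHomClass.commutes]
  · intro f
    rw [← map_star, ← heq, map_star, he, he]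
  · ext φ
    exact key φ
  · intro f g hfg
    rw [← he f, ← he g]
    exact (heq _ _).2 hfg

/-- The injective `*`-homomorphism `C(supportSet τ) → Calkin K` whose composition with the
restriction `C(M) → C(supportSet τ)` is `τ`. -/
def factorHom (τ : C(M, ℂ) →⋆ₐ[ℂ] Calkin K) : C(supportSet τ, ℂ) →⋆ₐ[ℂ] Calkin K :=
  (exists_factor τ).choose

theorem factorHom_comp (τ : C(M, ℂ) →⋆ₐ[ℂ] Calkin K) :
    (factorHom τ).comp (restrictHom (supportSet τ)) = τ := (exists_factor τ).choose_spec.1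

theorem factorHom_injective (τ : C(M, ℂ) →⋆ₐ[ℂ] Calkin K) : Function.Injective (factorHom τ) :=
  (exists_factor τ).choose_spec.2

end Support

section Ext

/-- A unital `*`-monomorphism from `C(X)` to the Calkin algebra of a separable Hilbert space.
If `X` is non-empty, then the Hilbert space is automatically infinite-dimensional, because the
Calkin algebra contains a copy of `C(X) ≠ 0`; if `X` is empty, it is finite-dimensional. -/
structure BDFExtension (X : Type v) [TopologicalSpace X] where
  space : Type u
  [normedAddCommGroup : NormedAddCommGroup space]
  [innerProductSpace : InnerProductSpace ℂ space]
  [completeSpace : CompleteSpace space]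
  [separableSpace : TopologicalSpace.SeparableSpace space]
  hom : C(X, ℂ) →⋆ₐ[ℂ] Calkin space
  injective : Function.Injective hom

attribute [instance] BDFExtension.normedAddCommGroup BDFExtension.innerProductSpace
  BDFExtension.completeSpace BDFExtension.separableSpace

/-- Unitary equivalence of extensions: some unitary `U` between the Hilbert spaces satisfies
`τ₂(φ) = π(U T U⁻¹)` whenever `τ₁(φ) = π(T)`. Over the empty space, where the group has to be
trivial, all extensions are identified. -/
def BDFExtension.Equivalent {X : Type v} [TopologicalSpace X] (a b : BDFExtension.{u, v} X) :
    Prop :=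
  IsEmpty X ∨ ∃ U : a.space ≃ₗᵢ[ℂ] b.space, ∀ (φ : C(X, ℂ)) (T : a.space →L[ℂ] a.space),
    a.hom φ = toCalkin T →
      b.hom φ = toCalkin ((U : a.space →L[ℂ] b.space) ∘L T ∘L (U.symm : b.space →L[ℂ] a.space))

theorem BDFExtension.equivalent_equivalence (X : Type v) [TopologicalSpace X] :
    Equivalence (BDFExtension.Equivalent (X := X) : BDFExtension.{u, v} X → _ → Prop) where
  refl a := Or.inr ⟨LinearIsometryEquiv.refl ℂ _, fun φ T h => by rw [h]; rfl⟩
  symm := by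
    rintro a b (h | ⟨U, hU⟩)
    · exact Or.inl h
    refine Or.inr ⟨U.symm, fun φ T h => ?_⟩
    obtain ⟨S, hS⟩ := toCalkin_surjective (a.hom φ)
    have h1 := hU φ S hS.symm
    rw [h, toCalkin_eq_iff] at h1
    rw [← hS, toCalkin_eq_iff]
    have h2 := ((h1.comp_clm (U : a.space →L[ℂ] b.space)).clm_comp
      (U.symm : b.space →L[ℂ] a.space)).neg
    have h3 : -⇑((U.symm : b.space →L[ℂ] a.space) ∘L
        (T - (U : a.space →L[ℂ] b.space) ∘L S ∘L (U.symm : b.space →L[ℂ] a.space)) ∘L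
          (U : a.space →L[ℂ] b.space)) =
        ⇑(S - (U.symm : b.space →L[ℂ] a.space) ∘L T ∘L
          (U.symm.symm : a.space →L[ℂ] b.space)) := by
      ext x
      simp
    exact h3 ▸ h2
  trans := by
    rintro a b c (h | ⟨U, hU⟩) (h' | ⟨V, hV⟩)
    · exact Or.inl h
    · exact Or.inl h
    · exact Or.inl h'
    refine Or.inr ⟨U.trans V, fun φ T h => ?_⟩
    rw [hV φ _ (hU φ T h)]
    rfl

instance BDFExtension.setoid (X : Type v) [TopologicalSpace X] : Setoid (BDFExtension.{u, v} X) :=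
  ⟨BDFExtension.Equivalent, BDFExtension.equivalent_equivalence X⟩

/-- The underlying set of the odd K-homology group `K₁(X) = Ext(X)` of Brown, Douglas and
Fillmore: unitary equivalence classes of unital `*`-monomorphisms from `C(X)` to the Calkin
algebra of a separable infinite-dimensional Hilbert space (one class if `X` is empty). -/
def KOne (X : Type v) [TopologicalSpace X] : Type (max v (u + 1)) :=
  Quotient (BDFExtension.setoid.{u, v} X)

variable {H : Type u} [NormedAddCommGroup H] [InnerProductSpace ℂ H] [CompleteSpace H]
  {M : Type v} [TopologicalSpace M] [CompactSpace M] [T2Space M]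
  {P : Submodule ℂ H} [CompleteSpace P] {σ : C(M, ℂ) →⋆ₐ[ℂ] Calkin H}

/-- The compact subset `M_P` of `M`. -/
def locus (hP : IsEssentiallyNormal P σ) : Set M := supportSet (compressedHom hP)

/-- The injective homomorphism `σ̂_P : C(M_P) → Calkin (ran P)` induced by `σ_P`. -/
def sigmaHat (hP : IsEssentiallyNormal P σ) : C(locus hP, ℂ) →⋆ₐ[ℂ] Calkin P :=
  factorHom (compressedHom hP)

/-- The class `[σ̂_P]` in `K₁(M_P)`. -/
def kClass (hP : IsEssentiallyNormal P σ) [TopologicalSpace.SeparableSpace P] :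
    KOne.{u, v} (locus hP) :=
  Quotient.mk (BDFExtension.setoid.{u, v} (locus hP))
    { space := P, hom := sigmaHat hP, injective := factorHom_injective _ }

/-- Transport of K-homology classes along an equality of subsets. -/
def KOne.transport {X Y : Set M} (h : X = Y) (a : KOne.{u, v} X) : KOne.{u, v} Y := h ▸ a

end Ext

end EssNormal

end

/-! Let `A : P → Q` be the restriction to `P` of the orthogonal projection onto `Q`. Its kernel is
`P ⊓ Qᗮ = ⊥`, and it is onto because `P ⊔ Qᗮ` is closed with orthogonal complement `Pᗮ ⊓ Q = ⊥`; so
`A` is invertible. If `T` represents `σ φ`, it commutes modulo compacts with both projections, so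
`A` intertwines the two compressions of `T` modulo compacts
(`isCompactOperator_compressOp_projRestrict`). The same holds for `star T`, which represents `σ
(star φ)`. Hence `A† A` essentially commutes with the compression of `T` to `P`, and so does `R =
√(A† A)` (`commute_toCalkin_cfc`). Therefore the unitary `U = A R⁻¹` intertwines the compressions
modulo compacts as well. One `U` serves all `φ`: it gives `σ_P` and `σ_Q` the same kernel, hence the
same locus, and it makes the induced extensions equivalent. -/

noncomputable section

namespace EssNormal

/-! ### Polar decomposition modulo compact operators -/

section PolarDecomposition

variable {E F : Type*} [NormedAddCommGroup E] [InnerProductSpace ℂ E] [CompleteSpace E]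
  [NormedAddCommGroup F] [InnerProductSpace ℂ F] [CompleteSpace F]

/-- An operator that essentially commutes with a self-adjoint operator essentially commutes with
its continuous functions. -/
theorem commute_toCalkin_cfc {a T : E →L[ℂ] E} (ha : IsSelfAdjoint a)
    (h : Commute (toCalkin a) (toCalkin T)) (f : ℝ → ℝ) :
    Commute (toCalkin (cfc f a)) (toCalkin T) := by
  -- The `by simp` settles the default value `cfc f a = 0`, taken when `f` is not continuous on the
  -- spectrum.
  refine cfc_cases (fun x => Commute (toCalkin x) (toCalkin T)) a f (by simp) fun hf _ => ?_
  generalize (⟨_, hf.domRestrict⟩ : C(spectrum ℝ a, ℝ)) = g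
  have hconst : ∀ r : ℝ, Commute (toCalkin (algebraMap ℝ (E →L[ℂ] E) r)) (toCalkin T) := fun r => by
    rw [IsScalarTower.algebraMap_apply ℝ ℂ (E →L[ℂ] E), AlgHomClass.commutes]
    exact Algebra.commutes _ _
  induction g using ContinuousMap.induction_on_of_compact with
  | const r =>
    have : cfcHom ha (ContinuousMap.const (spectrum ℝ a) r) = algebraMap ℝ (E →L[ℂ] E) r :=
      AlgHomClass.commutes (cfcHom ha) r
    rw [this]
    exact hconst r
  | id => rwa [cfcHom_id ha]
  | star_id => rwa [map_star, cfcHom_id ha, ha.star_eq]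
  | add f g hf hg => rw [map_add, map_add]; exact hf.add_left hg
  | mul f g hf hg => rw [map_mul, map_mul]; exact hf.mul_left hg
  | frequently f hf =>
    -- Limits are taken among operators, where compactness of the commutator with `T` is a
    -- norm-closed condition.
    have hcl : IsClosed {x : E →L[ℂ] E | Commute (toCalkin x) (toCalkin T)} := by
      have : {x : E →L[ℂ] E | Commute (toCalkin x) (toCalkin T)} =
          (fun x => x * T - T * x) ⁻¹' {S : E →L[ℂ] E | IsCompactOperator S} := by
        ext x
        change toCalkin x * toCalkin T = toCalkin T * toCalkin x ↔ _
        rw [← map_mul, ← map_mul, toCalkin_eq_iff]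
        rfl
      rw [this]
      exact isClosed_setOfPred_isCompactOperator.preimage (by fun_prop)
    change _ ∈ {x : E →L[ℂ] E | Commute (toCalkin x) (toCalkin T)}
    rw [← hcl.closure_eq]
    apply mem_closure_of_frequently_of_tendsto hf
    exact cfcHom_continuous ha |>.tendsto _

/-- Polar decomposition of an invertible operator. The positive part essentially commutes with every
operator that essentially commutes with `A† A`. -/
theorem exists_polar_decomposition (A : E ≃L[ℂ] F) :
    ∃ (U : E ≃ₗᵢ[ℂ] F) (R : (E →L[ℂ] E)ˣ),
      (A : E →L[ℂ] F) = (U : E →L[ℂ] F) ∘L (R : E →L[ℂ] E) ∧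
      ∀ T : E →L[ℂ] E,
        Commute (toCalkin (ContinuousLinearMap.adjoint (A : E →L[ℂ] F) ∘L (A : E →L[ℂ] F)))
          (toCalkin T) → Commute (toCalkin (R : E →L[ℂ] E)) (toCalkin T) := by
  set A' : E →L[ℂ] F := (A : E →L[ℂ] F) with hA'
  set B : E →L[ℂ] E := ContinuousLinearMap.adjoint A' ∘L A' with hB
  have hpos : 0 ≤ B :=
    (ContinuousLinearMap.nonneg_iff_isPositive _).2
      (ContinuousLinearMap.isPositive_adjoint_comp_self _)
  have hunit : IsUnit B := by
    set A'' : F →L[ℂ] E := (A.symm : F →L[ℂ] E) with hA''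
    have h1 : A'' ∘L A' = 1 := by ext x; simp [A', A'']
    have h2 : A' ∘L A'' = ContinuousLinearMap.id ℂ F := by ext x; simp [A', A'']
    -- The inverse of `A† A` is `A⁻¹ (A⁻¹)†`.
    refine ⟨⟨B, A'' ∘L ContinuousLinearMap.adjoint A'', ?_, ?_⟩, rfl⟩
    · change (ContinuousLinearMap.adjoint A' ∘L A') ∘L (A'' ∘L ContinuousLinearMap.adjoint A'') = 1
      rw [ContinuousLinearMap.comp_assoc, ← ContinuousLinearMap.comp_assoc A', h2,
        ContinuousLinearMap.id_comp, ← ContinuousLinearMap.adjoint_comp, h1]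
      exact star_one (E →L[ℂ] E)
    · change (A'' ∘L ContinuousLinearMap.adjoint A'') ∘L (ContinuousLinearMap.adjoint A' ∘L A') = 1
      rw [ContinuousLinearMap.comp_assoc, ← ContinuousLinearMap.comp_assoc _ _ A',
        ← ContinuousLinearMap.adjoint_comp, h2, ContinuousLinearMap.adjoint_id,
        ContinuousLinearMap.id_comp, h1]
  obtain ⟨R, hR⟩ := (CFC.isUnit_sqrt_iff B).2 hunit
  have hRR : (R : E →L[ℂ] E) * R = B := by rw [hR, CFC.sqrt_mul_sqrt_self B]
  have hRsa : star (R : E →L[ℂ] E) = R := by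
    rw [hR]; exact (CFC.sqrt_nonneg B).isSelfAdjoint.star_eq
  let V : E →L[ℂ] F := A' ∘L ((R⁻¹ : (E →L[ℂ] E)ˣ) : E →L[ℂ] E)
  -- `‖A x‖² = ⟪A† A x, x⟫ = ⟪R² x, x⟫ = ‖R x‖²`, which makes `V = A R⁻¹` isometric.
  have hnorm : ∀ x, ‖A' x‖ = ‖(R : E →L[ℂ] E) x‖ := fun x => by
    rw [← sq_eq_sq₀ (norm_nonneg _) (norm_nonneg _), ← inner_self_eq_norm_sq (𝕜 := ℂ),
      ← inner_self_eq_norm_sq (𝕜 := ℂ), ← ContinuousLinearMap.adjoint_inner_left A',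
      ← ContinuousLinearMap.adjoint_inner_left (R : E →L[ℂ] E),
      ← ContinuousLinearMap.star_eq_adjoint (R : E →L[ℂ] E), hRsa]
    have : ContinuousLinearMap.adjoint A' (A' x) = (R : E →L[ℂ] E) ((R : E →L[ℂ] E) x) :=
      (DFunLike.congr_fun hRR x).symm
    rw [this]
  have hVR : ∀ x, V ((R : E →L[ℂ] E) x) = A' x := fun x =>
    congrArg A' (DFunLike.congr_fun R.inv_mul x)
  have hRV : ∀ x, (R : E →L[ℂ] E) (((R⁻¹ : (E →L[ℂ] E)ˣ) : E →L[ℂ] E) x) = x := fun x =>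
    DFunLike.congr_fun R.mul_inv x
  let V' : E →ₗᵢ[ℂ] F := ⟨V, fun x => (hnorm _).trans (congrArg norm (hRV x))⟩
  have hsurj : Function.Surjective V' := fun y =>
    ⟨(R : E →L[ℂ] E) (A.symm y), (hVR _).trans (A.apply_symm_apply y)⟩
  refine ⟨LinearIsometryEquiv.ofSurjective V' hsurj, R, ?_, fun T hT => ?_⟩
  · ext x
    exact (hVR x).symm
  · rw [hR, CFC.sqrt_eq_cfc, cfc_nnreal_eq_real ..]
    exact commute_toCalkin_cfc hpos.isSelfAdjoint hT _

/-- If an invertible operator essentially intertwines `S` with `T` and `S†` with `T†`, then so does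
its unitary part. -/
theorem exists_unitary_of_essentially_intertwines (A : E ≃L[ℂ] F) :
    ∃ U : E ≃ₗᵢ[ℂ] F, ∀ (S : E →L[ℂ] E) (T : F →L[ℂ] F),
      IsCompactOperator (T ∘L (A : E →L[ℂ] F) - (A : E →L[ℂ] F) ∘L S) →
      IsCompactOperator (star T ∘L (A : E →L[ℂ] F) - (A : E →L[ℂ] F) ∘L star S) →
      toCalkin T = toCalkin ((U : E →L[ℂ] F) ∘L S ∘L (U.symm : F →L[ℂ] E)) := by
  obtain ⟨U, R, hAUR, hcomm⟩ := exists_polar_decomposition A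
  refine ⟨U, fun S T h1 h2 => ?_⟩
  generalize (A : E →L[ℂ] F) = A' at *
  have h2' := isCompactOperator_adjoint h2
  have hC : Commute (toCalkin (R : E →L[ℂ] E)) (toCalkin S) := by
    refine hcomm S ?_
    rw [commute_iff_eq, ← map_mul, ← map_mul, toCalkin_eq_iff]
    -- The adjoint of the second hypothesis says that `A† T - S A†` is compact; multiply it by `A`
    -- on the right, and `T A - A S` by `A†` on the left. The terms `A† T A` cancel.
    have : (ContinuousLinearMap.adjoint A' ∘L A') * S - S * (ContinuousLinearMap.adjoint A' ∘L A')
        = ContinuousLinearMap.adjoint (star T ∘L A' - A' ∘L star S) ∘L A'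
          - ContinuousLinearMap.adjoint A' ∘L (T ∘L A' - A' ∘L S) := by
      simp only [ContinuousLinearMap.star_eq_adjoint, map_sub, ContinuousLinearMap.adjoint_comp,
        ContinuousLinearMap.adjoint_adjoint]
      ext x
      simp
    rw [this]
    exact (h2'.comp_clm A').sub (h1.clm_comp (ContinuousLinearMap.adjoint A'))
  rw [commute_iff_eq, ← map_mul, ← map_mul, toCalkin_eq_iff] at hC
  rw [toCalkin_eq_iff]
  set R' : E →L[ℂ] E := ((R⁻¹ : (E →L[ℂ] E)ˣ) : E →L[ℂ] E) with hR'
  have hRV : ∀ x, (R : E →L[ℂ] E) (R' x) = x := fun x => DFunLike.congr_fun R.mul_inv x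
  -- Uses `A = U R`, so that `A R⁻¹ U⁻¹ = 1`; both summands are compact.
  have : T - (U : E →L[ℂ] F) ∘L S ∘L (U.symm : F →L[ℂ] E) =
      (T ∘L A' - A' ∘L S) ∘L (R' ∘L (U.symm : F →L[ℂ] E))
        + (U : E →L[ℂ] F) ∘L ((R : E →L[ℂ] E) * S - S * (R : E →L[ℂ] E)) ∘L (R' ∘L (U.symm : F →L[ℂ] E)) := by
    ext y
    simp [hAUR, hRV]
  rw [this]
  exact (h1.comp_clm _).add ((hC.comp_clm (R' ∘L (U.symm : F →L[ℂ] E))).clm_comp _)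

end PolarDecomposition

/-! ### The projection onto `Q` restricted to `P` -/

section Projections

variable {H : Type u} [NormedAddCommGroup H] [InnerProductSpace ℂ H] [CompleteSpace H]

/-- The orthogonal projection onto `Q`, restricted to `P`. -/
def projRestrict (P Q : Submodule ℂ H) [CompleteSpace Q] : P →L[ℂ] Q :=
  Q.orthogonalProjectionOnto ∘L P.subtypeL

variable {P Q : Submodule ℂ H} [CompleteSpace P] [CompleteSpace Q]

theorem ker_projRestrict (hPQ : P ⊓ Qᗮ = ⊥) : (projRestrict P Q).ker = ⊥ := by
  refine (Submodule.eq_bot_iff _).2 fun x hx => ?_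
  have h1 : (x : H) ∈ Qᗮ := Submodule.orthogonalProjectionOnto_eq_zero_iff.1 hx
  have h2 : (x : H) ∈ P ⊓ Qᗮ := ⟨x.2, h1⟩
  rw [hPQ] at h2
  exact Subtype.ext h2

/-- A closed subspace with zero orthogonal complement is the whole space, so each `y ∈ Q` is `p + z`
with `p ∈ P`, `z ∈ Qᗮ`; projecting onto `Q` kills `z` and sends `p` to `y`. -/
theorem range_projRestrict (hQP : Pᗮ ⊓ Q = ⊥)
    (hclosed : IsClosed ((P ⊔ Qᗮ : Submodule ℂ H) : Set H)) : (projRestrict P Q).range = ⊤ := by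
  have htop : P ⊔ Qᗮ = ⊤ := by
    have : CompleteSpace (P ⊔ Qᗮ : Submodule ℂ H) := hclosed.completeSpace_coe
    rw [← Submodule.orthogonal_eq_bot_iff, ← Submodule.inf_orthogonal,
      Submodule.orthogonal_orthogonal, hQP]
  refine LinearMap.range_eq_top.2 fun y => ?_
  obtain ⟨p, hp, z, hz, hpz⟩ := Submodule.mem_sup.1 (htop ▸ Submodule.mem_top : (y : H) ∈ P ⊔ Qᗮ)
  refine ⟨⟨p, hp⟩, ?_⟩
  change Q.orthogonalProjectionOnto p = y
  rw [← Submodule.orthogonalProjectionOnto_mem_subspace_eq_self y, ← hpz, map_add,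
    Submodule.orthogonalProjectionOnto_eq_zero_iff.2 hz, add_zero]

/-- The restricted projection essentially intertwines the compressions of an operator that
essentially commutes with both projections. -/
theorem isCompactOperator_compressOp_projRestrict {T : H →L[ℂ] H}
    (hP : Commute (toCalkin T) (toCalkin P.starProjection))
    (hQ : Commute (toCalkin T) (toCalkin Q.starProjection)) :
    IsCompactOperator (compressOp Q T ∘L projRestrict P Q - projRestrict P Q ∘L compressOp P T) := by
  rw [commute_iff_eq, ← map_mul, ← map_mul, toCalkin_eq_iff] at hP hQ
  -- On `x ∈ P` the two commutators contribute `Q T Q x - Q T x` and `Q T x - Q P T x`; the middle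
  -- terms cancel.
  have : compressOp Q T ∘L projRestrict P Q - projRestrict P Q ∘L compressOp P T =
      Q.orthogonalProjectionOnto ∘L
        ((T * Q.starProjection - Q.starProjection * T)
          + (T * P.starProjection - P.starProjection * T)) ∘L P.subtypeL := by
    ext x
    have hx : P.starProjection (x : H) = x := Submodule.starProjection_eq_self_iff.2 x.2
    have hy : ∀ y : H, Q.starProjection (Q.starProjection y) = Q.starProjection y := fun y =>
      Submodule.starProjection_eq_self_iff.2 (Submodule.starProjection_apply_mem _ _)
    simp [compressOp, projRestrict, hx, hy]
  rw [this]
  exact ((hQ.add hP).comp_clm P.subtypeL).clm_comp Q.orthogonalProjectionOnto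

end Projections

/-! ### Unitary equivalence, supports and K-homology classes -/

section Classes

variable {M : Type v} [TopologicalSpace M]

theorem toCalkin_conj_eq_zero_iff {E F : Type*} [NormedAddCommGroup E] [InnerProductSpace ℂ E]
    [CompleteSpace E] [NormedAddCommGroup F] [InnerProductSpace ℂ F] [CompleteSpace F]
    (U : E ≃ₗᵢ[ℂ] F) (S : E →L[ℂ] E) :
    toCalkin ((U : E →L[ℂ] F) ∘L S ∘L (U.symm : F →L[ℂ] E)) = 0 ↔ toCalkin S = 0 := by
  rw [toCalkin_eq_zero_iff, toCalkin_eq_zero_iff]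
  refine ⟨fun h => ?_, fun h => (h.comp_clm _).clm_comp _⟩
  have h1 := (h.comp_clm (U : E →L[ℂ] F)).clm_comp (U.symm : F →L[ℂ] E)
  have h2 : S = (U.symm : F →L[ℂ] E) ∘L
      ((U : E →L[ℂ] F) ∘L S ∘L (U.symm : F →L[ℂ] E)) ∘L (U : E →L[ℂ] F) := by
    ext x; simp
  rw [h2]
  exact h1

/-- Unitarily equivalent homomorphisms have the same kernel, hence the same support. -/
theorem supportSet_eq_of_unitary {E F : Type u} [NormedAddCommGroup E] [InnerProductSpace ℂ E]
    [CompleteSpace E] [NormedAddCommGroup F] [InnerProductSpace ℂ F] [CompleteSpace F]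
    {τ₁ : C(M, ℂ) →⋆ₐ[ℂ] Calkin E} {τ₂ : C(M, ℂ) →⋆ₐ[ℂ] Calkin F} (U : E ≃ₗᵢ[ℂ] F)
    (hU : ∀ (φ : C(M, ℂ)) (S : E →L[ℂ] E), τ₁ φ = toCalkin S →
      τ₂ φ = toCalkin ((U : E →L[ℂ] F) ∘L S ∘L (U.symm : F →L[ℂ] E))) :
    supportSet τ₁ = supportSet τ₂ := by
  have : ∀ φ, τ₁ φ = 0 ↔ τ₂ φ = 0 := fun φ => by
    obtain ⟨S, hS⟩ := toCalkin_surjective (τ₁ φ)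
    rw [hU φ S hS.symm, toCalkin_conj_eq_zero_iff, hS]
  simp only [supportSet, this]

/-- With `X` and `Y` free, the equality can be substituted and the transport disappears. Since
restriction from `M` is onto, equivalence need only be tested on functions on `M`, which do not
depend on the subset. -/
theorem KOne.mk_eq_transport {X Y : Set M} (h : Y = X) (a : BDFExtension.{u, v} X)
    (b : BDFExtension.{u, v} Y)
    (hsurj : Function.Surjective (restrictHom X)) (U : a.space ≃ₗᵢ[ℂ] b.space)
    (hU : ∀ (φ : C(M, ℂ)) (S : a.space →L[ℂ] a.space), a.hom (restrictHom X φ) = toCalkin S →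
      b.hom (restrictHom Y φ) =
        toCalkin ((U : a.space →L[ℂ] b.space) ∘L S ∘L (U.symm : b.space →L[ℂ] a.space))) :
    (Quotient.mk (BDFExtension.setoid.{u, v} X) a : KOne.{u, v} X) =
      KOne.transport h (Quotient.mk (BDFExtension.setoid.{u, v} Y) b) := by
  subst h
  refine Quotient.sound (Or.inr ⟨U, fun f S hS => ?_⟩)
  obtain ⟨φ, rfl⟩ := hsurj f
  exact hU φ S hS

variable {H : Type u} [NormedAddCommGroup H] [InnerProductSpace ℂ H] [CompleteSpace H]
  {P Q : Submodule ℂ H} [CompleteSpace P] [CompleteSpace Q] {σ : C(M, ℂ) →⋆ₐ[ℂ] Calkin H}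

/-- Working on all of `M`, before passing to the loci, yields both the equality of the loci and that
of the classes. -/
theorem exists_unitary_compressedHom (hP : IsEssentiallyNormal P σ) (hQ : IsEssentiallyNormal Q σ)
    (hPQ : P ⊓ Qᗮ = ⊥) (hQP : Pᗮ ⊓ Q = ⊥)
    (hclosed : IsClosed ((P ⊔ Qᗮ : Submodule ℂ H) : Set H)) :
    ∃ U : P ≃ₗᵢ[ℂ] Q, ∀ (φ : C(M, ℂ)) (S : P →L[ℂ] P), compressedHom hP φ = toCalkin S →
      compressedHom hQ φ =
        toCalkin ((U : P →L[ℂ] Q) ∘L S ∘L (U.symm : Q →L[ℂ] P)) := by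
  obtain ⟨U, hU⟩ := exists_unitary_of_essentially_intertwines
    (ContinuousLinearEquiv.ofBijective (projRestrict P Q) (ker_projRestrict hPQ)
      (range_projRestrict hQP hclosed))
  rw [ContinuousLinearEquiv.coe_ofBijective] at hU
  refine ⟨U, fun φ S hS => ?_⟩
  obtain ⟨T, hT⟩ := toCalkin_surjective (σ φ)
  have hT' : toCalkin (star T) = σ (star φ) := by
    rw [← star_toCalkin, hT, map_star]
  have hP1 : compressedHom hP φ = toCalkin (compressOp P T) :=
    (congrArg (compress P) hT).symm
  have hQ1 : compressedHom hQ φ = toCalkin (compressOp Q T) :=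
    (congrArg (compress Q) hT).symm
  have key := hU (compressOp P T) (compressOp Q T)
    (isCompactOperator_compressOp_projRestrict (hT ▸ hP φ) (hT ▸ hQ φ))
    (by
      rw [← compressOp_star, ← compressOp_star]
      exact isCompactOperator_compressOp_projRestrict (hT' ▸ hP (star φ)) (hT' ▸ hQ (star φ)))
  -- `S` is an arbitrary lift of `σ_P φ`; it differs from the compression of `T` by a compact
  -- operator, which stays compact under conjugation by `U`.
  rw [hQ1, key, ← sub_eq_zero, ← map_sub, ← ContinuousLinearMap.comp_sub,
    ← ContinuousLinearMap.sub_comp, toCalkin_conj_eq_zero_iff, map_sub, ← hP1, hS, sub_self]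

end Classes

end EssNormal

end

theorem theorem4p4 {H : Type u} [NormedAddCommGroup H] [InnerProductSpace ℂ H]
    [CompleteSpace H] {M : Type v} [MetricSpace M] [CompactSpace M]
    (σ : C(M, ℂ) →⋆ₐ[ℂ] EssNormal.Calkin H)
    (P Q : Submodule ℂ H) [CompleteSpace P] [CompleteSpace Q]
    (hP : EssNormal.IsEssentiallyNormal P σ) (hQ : EssNormal.IsEssentiallyNormal Q σ)
    (hPQ : P ⊓ Qᗮ = ⊥) (hQP : Pᗮ ⊓ Q = ⊥)
    (hclosed : IsClosed ((P ⊔ Qᗮ : Submodule ℂ H) : Set H)) :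
    ∃ h : EssNormal.locus hP = EssNormal.locus hQ,
      ∀ [TopologicalSpace.SeparableSpace P] [TopologicalSpace.SeparableSpace Q],
        EssNormal.kClass hP = EssNormal.KOne.transport h.symm (EssNormal.kClass hQ) := by
  obtain ⟨U, hU⟩ := EssNormal.exists_unitary_compressedHom hP hQ hPQ hQP hclosed
  refine ⟨EssNormal.supportSet_eq_of_unitary U hU, ?_⟩
  intro _ _
  refine EssNormal.KOne.mk_eq_transport _ _ _ (fun f => ?_) U fun φ S hS => ?_
  -- Tietze extension from the closed set `locus hP`.
  · obtain ⟨g, hg⟩ := ContinuousMap.exists_restrict_eq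
      (EssNormal.isClosed_supportSet (EssNormal.compressedHom hP)) f
    exact ⟨g, hg⟩
  · exact (DFunLike.congr_fun (EssNormal.factorHom_comp (EssNormal.compressedHom hQ)) φ).trans
      (hU φ S ((DFunLike.congr_fun
        (EssNormal.factorHom_comp (EssNormal.compressedHom hP)) φ).symm.trans hS))
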